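/- Let $m_{12},m_{23}\ge 2$ be integers such that the product $m_{12}m_{23}$ is divisible neither by $2$ nor by $3$, and let $$W=\langle s_1,s_2,s_3 \mid s_1^2=s_2^2=s_3^2=1,\ (s_1s_2)^{m_{12}}=(s_2s_3)^{m_{23}}=1\rangle$$ be the Coxeter group of rank $3$ with exponents $m_{12}$, $m_{23}$ and $m_{13}=\infty$ (i.e. there is no relation on $s_1s_3$). A reflection of $W$ is an element conjugate in $W$ to one of $s_1,s_2,s_3$, and a reflection subgroup of $W$ is a proper subgroup (of index greater than one) generated by reflections. Then $W$ has no reflection subgroup of finite index. -/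

import Mathlib

/-- A subgroup `V` of the Coxeter group `W` is a *reflection subgroup* if it is proper (that is, of
index greater than one) and generated by a set of reflections of the Coxeter system `cs`, where a
reflection is a conjugate in `W` of a simple reflection. -/
def CoxeterSystem.IsReflectionSubgroup {B : Type*} {M : CoxeterMatrix B} {W : Type*} [Group W]
    (cs : CoxeterSystem M W) (V : Subgroup W) : Prop :=
  V ≠ ⊤ ∧ ∃ T : Set W, (∀ t ∈ T, cs.IsReflection t) ∧ V = Subgroup.closure T

/-!
Let `V` be generated by reflections and let `X = W ⧸ V` be finite. A reflection in `V` is a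
conjugate of a simple reflection fixing a point of `X`. Hence a `W`-set over `X` in which `sᵢ`
fixes every point lying over a fixed point of `sᵢ` has a section: some lift of the base coset is
fixed by all of `V`. Applied to skew products `X × A`, this makes every 1-cocycle on `X` that
vanishes on the loops `sᵢ • x = x` a coboundary, with two consequences.

* If `sᵢ` and `s₂` agree at a point of `X`, for `i = 1` or `3`, they fix it; otherwise the double
  edge at that point would carry a non-trivial cocycle with values in `ZMod (m i 2)`.
* `W` is the amalgam of `⟨s₁, s₂⟩` and `⟨s₃, s₂⟩` over `⟨s₂⟩`, and the quotient by `V` of its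
  Bass-Serre tree has no cycles. As vertices are orbits of the two dihedral groups and edges are
  orbits of `⟨s₂⟩`, the number of edges is at most the number of vertices minus one.

An orbit of `⟨sᵢ, s₂⟩` with more than one point contains a cycle of the rotation `sᵢ s₂` whose
length is coprime to `6`, hence at least `5`, and `s₂` moves all but at most one point of it. So the
number of these orbits is at most the number of points fixed by `⟨sᵢ, s₂⟩` plus a quarter of the
number of points moved by `s₂`. Comparing with the number of `⟨s₂⟩`-orbits, `s₂` has fewer fixed
points than `⟨s₁, s₂⟩` and `⟨s₃, s₂⟩` have together; a common fixed point exists, and so `V = W`.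
-/

open MulAction Subgroup

section GroupAction

variable {G X Y : Type*} [Group G] [MulAction G X]

theorem apply_smul_eq_of_mem_closure {S : Set G} {f : X → Y} (hf : ∀ g ∈ S, ∀ x, f (g • x) = f x)
    {g : G} (hg : g ∈ closure S) (x : X) : f (g • x) = f x := by
  induction hg using closure_induction generalizing x with
  | mem g hg => exact hf g hg x
  | one => rw [one_smul]
  | mul g h _ _ ihg ihh => rw [mul_smul, ihg, ihh]
  | inv g _ ih => rw [← ih, smul_inv_smul]

theorem eq_top_of_forall_smul_eq {V : Subgroup G} {x : G ⧸ V} (hx : ∀ g : G, g • x = x) :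
    V = ⊤ := by
  have hsub : Subsingleton (G ⧸ V) := subsingleton_of_forall_eq x fun y => by
    obtain ⟨g, rfl⟩ := exists_smul_eq G x y
    exact hx g
  exact QuotientGroup.subgroup_eq_top_of_subsingleton V hsub

theorem smul_eq_of_pow_smul_eq_of_coprime {g : G} {m n : ℕ} (hg : g ^ m = 1) (hmn : m.Coprime n)
    {x : X} (hx : g ^ n • x = x) : g • x = x := by
  rw [← period_eq_one_iff]
  refine Nat.eq_one_of_dvd_coprimes hmn ?_ (pow_smul_eq_iff_period_dvd.1 hx)
  rw [← pow_smul_eq_iff_period_dvd, hg, one_smul]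

theorem card_add_ncard_fixedBy_le_two_mul_card_orbits [Finite X] {s : G} (hs : s * s = 1)
    {H : Subgroup G} (hH : H ≤ zpowers s) :
    Nat.card X + (fixedBy X s).ncard ≤ 2 * Nat.card (orbitRel.Quotient H X) := by
  have horbit (x : X) : ∃ d ∈ Set.range (Quotient.out : orbitRel.Quotient H X → X),
      d = x ∨ d = s • x := by
    refine ⟨_, Set.mem_range_self (Quotient.mk _ x), ?_⟩
    obtain ⟨⟨h, hh⟩, hx⟩ : (Quotient.mk (orbitRel H X) x).out ∈ orbit H x :=
      Quotient.mk_out (s := orbitRel H X) x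
    obtain ⟨k, rfl⟩ := hH hh
    rw [← hx]
    have hs2 : s ^ 2 = 1 := by rw [pow_two, hs]
    rcases Int.even_or_odd' k with ⟨l, rfl | rfl⟩
    · left
      simp [zpow_mul, hs2, Subgroup.smul_def]
    · right
      simp [zpow_add, zpow_mul, hs2, Subgroup.smul_def]
  set D := Set.range (Quotient.out : orbitRel.Quotient H X → X)
  have hss (x : X) : s • s • x = x := by rw [smul_smul, hs, one_smul]
  have hunion : D ∪ (s • ·) '' D = Set.univ := Set.eq_univ_of_forall fun x => by
    obtain ⟨d, hd, rfl | rfl⟩ := horbit x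
    · exact Or.inl hd
    · exact Or.inr ⟨_, hd, hss x⟩
  have hinter : fixedBy X s ⊆ D ∩ (s • ·) '' D := fun x (hx : s • x = x) => by
    obtain ⟨d, hd, hdx⟩ := horbit x
    obtain rfl : d = x := by rwa [hx, or_self] at hdx
    exact ⟨hd, d, hd, hx⟩
  calc Nat.card X + (fixedBy X s).ncard
      ≤ (D ∪ (s • ·) '' D).ncard + (D ∩ (s • ·) '' D).ncard := by
        rw [hunion, Set.ncard_univ]
        exact Nat.add_le_add_left (Set.ncard_le_ncard hinter) _
    _ = D.ncard + ((s • ·) '' D).ncard := Set.ncard_union_add_ncard_inter _ _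
    _ ≤ D.ncard + D.ncard := Nat.add_le_add_left (Set.ncard_image_le D.toFinite) _
    _ = 2 * Nat.card (orbitRel.Quotient H X) := by
        rw [← two_mul, Set.ncard_range_of_injective Quotient.out_injective]

end GroupAction

section Counting

variable {P Q R : Type*}

theorem card_add_one_le_of_forall_eq_comp_add_comp [Finite P] [Finite Q] [Finite R] [Nonempty Q]
    (a : Q → P) (b : Q → R)
    (h : ∀ g : Q → ZMod 2, ∃ (u : P → ZMod 2) (v : R → ZMod 2), ∀ q, g q = u (a q) + v (b q)) :
    Nat.card Q + 1 ≤ Nat.card P + Nat.card R := by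
  classical
  have := Fintype.ofFinite P
  have := Fintype.ofFinite Q
  have := Fintype.ofFinite R
  let Φ (p : (P → ZMod 2) × (R → ZMod 2)) (q : Q) : ZMod 2 := p.1 (a q) + p.2 (b q)
  have hsurj : Function.Surjective Φ := fun g => by
    obtain ⟨u, v, huv⟩ := h g
    exact ⟨(u, v), funext fun q => (huv q).symm⟩
  have hninj : ¬ Function.Injective Φ := fun hinj => by
    have h11 : Φ (1, 1) = Φ (0, 0) := funext fun _ => by
      change (1 : ZMod 2) + 1 = 0 + 0
      decide
    obtain ⟨q⟩ := ‹Nonempty Q›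
    exact one_ne_zero (congrFun (congrArg Prod.fst (hinj h11)) (a q))
  have hcard := Fintype.card_lt_of_surjective_not_injective Φ hsurj hninj
  rw [Fintype.card_prod, Fintype.card_fun, Fintype.card_fun, Fintype.card_fun, ZMod.card,
    ← pow_add] at hcard
  simpa only [Nat.card_eq_fintype_card, Nat.succ_le_iff] using
    (Nat.pow_lt_pow_iff_right one_lt_two).1 hcard

open Finset in
theorem ncard_eq_sum_ncard_inter_preimage [Finite P] [Fintype Q] (π : P → Q) (S : Set P) :
    S.ncard = ∑ q, (S ∩ π ⁻¹' {q}).ncard := by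
  classical
  have := Fintype.ofFinite P
  simp only [Set.ncard_eq_toFinset_card']
  rw [card_eq_sum_card_fiberwise (f := π) (t := univ) fun _ _ => mem_coe.2 (mem_univ _)]
  refine sum_congr rfl fun q _ => congrArg card ?_
  ext x
  simp

theorem inter_nonempty_of_ncard_lt_ncard_add_ncard [Finite P] {S T U : Set P} (hT : T ⊆ S)
    (hU : U ⊆ S) (h : S.ncard < T.ncard + U.ncard) : (T ∩ U).Nonempty := by
  have hunion : (T ∪ U).ncard ≤ S.ncard := Set.ncard_le_ncard (Set.union_subset hT hU)
  have hcard := Set.ncard_union_add_ncard_inter T U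
  rw [← Set.ncard_pos]
  omega

end Counting

section Dihedral

variable {G X : Type*} [Group G] [MulAction G X] {s t : G} {m : ℕ}

theorem smul_eq_of_mem_zpowers_of_fixed (hs : s * s = 1) (ht : t * t = 1) (hst : (s * t) ^ m = 1)
    (hm : m.Coprime 2) {g : G} (hg : g ∈ zpowers (s * t)) {x : X} (hx : t • x = x)
    (hgx : t • g • x = g • x) : g • x = x := by
  obtain ⟨k, rfl⟩ := hg
  have hconj : SemiconjBy t (s * t) (s * t)⁻¹ := by
    rw [SemiconjBy, mul_inv_rev, inv_eq_of_mul_eq_one_left hs, inv_eq_of_mul_eq_one_left ht,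
      mul_assoc]
  have hinv : ((s * t) ^ k)⁻¹ • x = (s * t) ^ k • x := by
    rw [← hgx, smul_smul, (hconj.zpow_right k).eq, mul_smul, hx, inv_zpow]
  have hpow : ((s * t) ^ k) ^ m = 1 := by
    rw [← zpow_natCast, zpow_comm, zpow_natCast, hst, one_zpow]
  refine smul_eq_of_pow_smul_eq_of_coprime hpow hm ?_
  rw [pow_two, mul_smul, smul_eq_iff_eq_inv_smul, hinv]

theorem five_le_ncard_orbit_zpowers [Finite X] {g : G} (hg : g ^ m = 1) (hm : m.Coprime 6) {x : X}
    (hx : g • x ≠ x) : 5 ≤ (orbit (zpowers g) x).ncard := by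
  classical
  have := Fintype.ofFinite (orbit (zpowers g) x)
  have hperiod : (orbit (zpowers g) x).ncard = period g x := by
    rw [← Nat.card_coe_set_eq, Nat.card_eq_fintype_card, ← minimalPeriod_eq_card,
      period_eq_minimalPeriod]
  rw [hperiod]
  have hdvd : period g x ∣ m := by rw [← pow_smul_eq_iff_period_dvd, hg, one_smul]
  have hcop : (period g x).Coprime 6 := hm.coprime_dvd_left hdvd
  have hne : period g x ≠ 1 := mt period_eq_one_iff.1 hx
  by_contra! hlt
  interval_cases period g x <;> revert hcop <;> first | decide | exact absurd rfl hne

theorem four_le_ncard_orbit_zpowers_diff_fixedBy [Finite X] (hs : s * s = 1) (ht : t * t = 1)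
    (hst : (s * t) ^ m = 1) (hm : m.Coprime 6) {x : X} (hx : (s * t) • x ≠ x) :
    4 ≤ (orbit (zpowers (s * t)) x \ fixedBy X t).ncard := by
  have hfixed : (orbit (zpowers (s * t)) x ∩ fixedBy X t).ncard ≤ 1 := by
    rw [Set.ncard_le_one]
    rintro y ⟨hy, hty⟩ z ⟨hz, htz⟩
    obtain ⟨g, rfl⟩ : z ∈ orbit (zpowers (s * t)) y := by rwa [orbit_eq_iff.2 hy]
    exact (smul_eq_of_mem_zpowers_of_fixed hs ht hst (hm.coprime_dvd_right (by decide)) g.2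
      hty htz).symm
  have horbit := five_le_ncard_orbit_zpowers hst hm hx
  have hsplit := Set.ncard_inter_add_ncard_sdiff_eq_ncard (orbit (zpowers (s * t)) x) (fixedBy X t)
  omega

theorem four_mul_card_orbits_le [Finite X] (hs : s * s = 1) (ht : t * t = 1)
    (hst : (s * t) ^ m = 1) (hm : m.Coprime 6) (hfix : ∀ x : X, s • x = t • x → s • x = x)
    {H : Subgroup G} (hsH : s ∈ H) (htH : t ∈ H) :
    4 * Nat.card (orbitRel.Quotient H X) ≤
      4 * (fixedBy X s ∩ fixedBy X t).ncard + (fixedBy X t)ᶜ.ncard := by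
  have := Fintype.ofFinite (orbitRel.Quotient H X)
  let π : X → orbitRel.Quotient H X := Quotient.mk _
  rw [Nat.card_eq_fintype_card, ncard_eq_sum_ncard_inter_preimage π (fixedBy X s ∩ fixedBy X t),
    ncard_eq_sum_ncard_inter_preimage π (fixedBy X t)ᶜ, Finset.mul_sum, ← Finset.sum_add_distrib,
    mul_comm, ← Finset.card_univ, ← smul_eq_mul]
  refine Finset.card_nsmul_le_sum _ _ _ fun q _ => ?_
  obtain ⟨x, rfl⟩ := Quotient.exists_rep q
  by_cases hx : x ∈ fixedBy X s ∩ fixedBy X t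
  · have hpos : 0 < (fixedBy X s ∩ fixedBy X t ∩ π ⁻¹' {π x}).ncard :=
      (Set.ncard_pos (Set.toFinite _)).2 ⟨x, hx, rfl⟩
    exact le_add_right (Nat.mul_le_mul_left 4 hpos)
  · have hmove : (s * t) • x ≠ x := fun h => by
      have hst : s • x = t • x := by
        rw [mul_smul, smul_eq_iff_eq_inv_smul, inv_eq_of_mul_eq_one_left hs] at h
        exact h.symm
      exact hx ⟨hfix x hst, hst.symm.trans (hfix x hst)⟩
    refine le_add_left ((four_le_ncard_orbit_zpowers_diff_fixedBy hs ht hst hm hmove).trans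
      (Set.ncard_le_ncard ?_))
    rintro _ ⟨⟨⟨g, hg⟩, rfl⟩, hgt⟩
    have hgH : g ∈ H := (zpowers_le.2 (mul_mem hsH htH)) hg
    exact ⟨hgt, Quotient.sound (s := orbitRel H X) ⟨⟨g, hgH⟩, rfl⟩⟩

end Dihedral

section Cocycle

variable {B W X A : Type*} {M : CoxeterMatrix B} [Group W] [MulAction W X] [AddCommGroup A]
  (cs : CoxeterSystem M W)

/-- The sum of `c` along the loop based at `x` in the Schreier graph of `X` that is labelled by the
relator `(sᵢ sⱼ) ^ M i j`, where `c k x` is the value of `c` on the edge from `x` to `sₖ • x`. -/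
def braidSum (c : B → X → A) (i j : B) (x : X) : A :=
  birkhoffSum ((cs.simple i * cs.simple j) • ·) (fun x => c j x + c i (cs.simple j • x)) (M i j) x

/-- An `A`-valued 1-cocycle on the action groupoid of `W` on `X`, given by its values on the
generators. -/
def IsCoxeterCocycle (c : B → X → A) : Prop :=
  ∀ i j x, braidSum cs c i j x = 0

variable {cs} in
theorem braidSum_eq_zero_of_matrix_eq_zero (c : B → X → A) {i j : B} (h : M i j = 0) (x : X) :
    braidSum cs c i j x = 0 := by
  rw [braidSum, h, birkhoffSum_zero]

variable {cs} in
theorem braidSum_eq_zero_of_invariant {c : B → X → A} {i j : B}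
    (hinv : ∀ x, c j (cs.simple i • cs.simple j • x) +
      c i (cs.simple j • cs.simple i • cs.simple j • x) = c j x + c i (cs.simple j • x))
    (hA : ∀ a : A, M i j • a = 0) (x : X) : braidSum cs c i j x = 0 := by
  rw [braidSum, birkhoffSum_of_comp_eq, Pi.smul_apply, hA]
  funext x
  simpa only [Function.comp_apply, mul_smul] using hinv x

variable {cs} in
theorem braidSum_eq_zero_of_coboundary {c : B → X → A} {h : X → A} {i j : B}
    (hi : ∀ x, c i x = h (cs.simple i • x) - h x) (hj : ∀ x, c j x = h (cs.simple j • x) - h x)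
    (x : X) : braidSum cs c i j x = 0 := by
  have htelescope : (fun x => c j x + c i (cs.simple j • x)) =
      h ∘ ((cs.simple i * cs.simple j) • ·) - h := by
    funext x
    rw [hi, hj, sub_add_sub_cancel', Pi.sub_apply, Function.comp_apply, mul_smul]
  have hcomp : birkhoffSum ((cs.simple i * cs.simple j) • ·)
      (h ∘ ((cs.simple i * cs.simple j) • ·)) (M i j) x =
        birkhoffSum ((cs.simple i * cs.simple j) • ·) h (M i j)
          ((cs.simple i * cs.simple j) • x) := by
    simp only [birkhoffSum, Function.comp_apply, ← Function.iterate_succ_apply,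
      ← Function.iterate_succ_apply']
  rw [braidSum, htelescope, birkhoffSum_sub, hcomp, birkhoffSum_apply_sub_birkhoffSum,
    smul_iterate_apply, cs.simple_mul_simple_pow, one_smul, sub_self]

variable {cs} in
theorem isCoxeterCocycle_single [DecidableEq B] {i j : B} (hi : ∀ k, k ≠ i → k ≠ j → M i k = 0)
    (hA : ∀ a : A, M i j • a = 0) {h : X → A}
    (hh : ∀ x, h (cs.simple i • x) = h (cs.simple j • x)) :
    IsCoxeterCocycle cs (Pi.single i fun x => h (cs.simple i • x) - h x) := by
  set c : B → X → A := Pi.single i fun x => h (cs.simple i • x) - h x with hc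
  have hci (x : X) : c i x = h (cs.simple i • x) - h x := by rw [hc, Pi.single_eq_same]
  have hck {k : B} (hk : k ≠ i) (x : X) : c k x = 0 := by
    rw [hc, Pi.single_eq_of_ne hk, Pi.zero_apply]
  have hss (k : B) (x : X) : cs.simple k • cs.simple k • x = x := by
    rw [smul_smul, cs.simple_mul_simple_self, one_smul]
  have hij (x : X) : h (cs.simple i • cs.simple j • x) = h x := by rw [hh, hss]
  have hji (x : X) : h (cs.simple j • cs.simple i • x) = h x := by rw [← hh, hss]
  have hA' (a : A) : M j i • a = 0 := by rw [M.symmetric, hA]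
  intro k l x
  by_cases hk : k = i <;> by_cases hl : l = i
  · subst hk hl
    exact braidSum_eq_zero_of_coboundary hci hci x
  · subst hk
    by_cases hlj : l = j
    · subst hlj
      refine braidSum_eq_zero_of_invariant (fun x => ?_) hA x
      simp only [hck hl, hci, hij, hji]
    · exact braidSum_eq_zero_of_matrix_eq_zero c (hi l hl hlj) x
  · subst hl
    by_cases hkj : k = j
    · subst hkj
      refine braidSum_eq_zero_of_invariant (fun x => ?_) hA' x
      simp only [hck hk, hci, hij, hji]
    · exact braidSum_eq_zero_of_matrix_eq_zero c ((M.symmetric k l).trans (hi k hk hkj)) x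
  · exact braidSum_eq_zero_of_coboundary (h := 0) (by simp [hck hk]) (by simp [hck hl]) x

/-- The permutation of `X × A` covering the action of `sᵢ` on `X` and translating the fibre over
`x` by `c i x`. -/
def skewSimple (c : B → X → A) (i : B) : Equiv.Perm (X × A) :=
  (MulAction.toPerm (cs.simple i)).prodShear fun x => Equiv.addRight (c i x)

theorem skewSimple_apply (c : B → X → A) (i : B) (x : X) (a : A) :
    skewSimple cs c i (x, a) = (cs.simple i • x, a + c i x) := rfl

theorem skewSimple_mul_pow_apply (c : B → X → A) (i j : B) (n : ℕ) (x : X) (a : A) :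
    ((skewSimple cs c i * skewSimple cs c j) ^ n) (x, a) =
      ((cs.simple i * cs.simple j) ^ n • x,
        a + birkhoffSum ((cs.simple i * cs.simple j) • ·)
          (fun x => c j x + c i (cs.simple j • x)) n x) := by
  induction n with
  | zero => simp
  | succ n ih =>
    simp only [pow_succ', Equiv.Perm.mul_apply, ih, skewSimple_apply, birkhoffSum_succ,
      smul_iterate_apply]
    simp only [mul_smul, add_assoc]

variable {cs}

theorem IsCoxeterCocycle.isLiftable {c : B → X → A} (hc : IsCoxeterCocycle cs c) :
    M.IsLiftable (skewSimple cs c) := fun i j => by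
  ext1 ⟨x, a⟩
  rw [skewSimple_mul_pow_apply, cs.simple_mul_simple_pow, one_smul, ← braidSum, hc i j x, add_zero,
    Equiv.Perm.one_apply]

/-- The action of `W` on the skew product `X × A` defined by a cocycle. -/
def IsCoxeterCocycle.skewHom {c : B → X → A} (hc : IsCoxeterCocycle cs c) :
    W →* Equiv.Perm (X × A) :=
  cs.lift ⟨skewSimple cs c, hc.isLiftable⟩

theorem IsCoxeterCocycle.skewHom_simple_apply {c : B → X → A} (hc : IsCoxeterCocycle cs c) (i : B)
    (x : X) (a : A) : hc.skewHom (cs.simple i) (x, a) = (cs.simple i • x, a + c i x) := by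
  rw [skewHom, cs.lift_apply_simple, skewSimple_apply]

theorem IsCoxeterCocycle.skewHom_apply_fst {c : B → X → A} (hc : IsCoxeterCocycle cs c) (w : W)
    (p : X × A) : (hc.skewHom w p).1 = w • p.1 := by
  induction w using cs.simple_induction generalizing p with
  | simple i => rw [hc.skewHom_simple_apply]
  | one => rw [map_one, Equiv.Perm.one_apply, one_smul]
  | mul v w ihv ihw => rw [map_mul, Equiv.Perm.mul_apply, ihv, ihw, mul_smul]

end Cocycle

section ReflectionSubgroup

variable {B W : Type*} {M : CoxeterMatrix B} [Group W] {cs : CoxeterSystem M W} {T : Set W}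

theorem exists_equivariant_section (hT : ∀ t ∈ T, cs.IsReflection t) {E : Type*} [MulAction W E]
    (p : E →[W] W ⧸ closure T) (hp : Function.Surjective p)
    (hfix : ∀ i e, cs.simple i • p e = p e → cs.simple i • e = e) :
    ∃ σ : W ⧸ closure T →[W] E, ∀ x, p (σ x) = x := by
  obtain ⟨e, he⟩ := hp ((1 : W) : W ⧸ closure T)
  have hpe (w : W) : p (w • e) = (w : W ⧸ closure T) := by
    rw [map_smul, he, MulAction.Quotient.smul_coe, smul_eq_mul, mul_one]
  have hstab : closure T ≤ stabilizer W e := (closure_le _).2 fun t ht => by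
    obtain ⟨w, i, rfl⟩ := hT t ht
    have hmem : cs.simple i • p (w⁻¹ • e) = p (w⁻¹ • e) := by
      rw [hpe, MulAction.Quotient.smul_coe, smul_eq_mul, eq_comm, QuotientGroup.eq, inv_inv,
        ← mul_assoc]
      exact subset_closure ht
    rw [SetLike.mem_coe, mem_stabilizer_iff, mul_smul, mul_smul, hfix i _ hmem, smul_inv_smul]
  let σ : W ⧸ closure T → E := Quotient.lift (· • e) fun v w hvw => by
    have hmem : v⁻¹ * w ∈ stabilizer W e := hstab (QuotientGroup.leftRel_apply.1 hvw)
    rwa [mem_stabilizer_iff, mul_smul, inv_smul_eq_iff, eq_comm] at hmem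
  refine ⟨⟨σ, fun w x => ?_⟩, fun x => ?_⟩ <;> induction x using QuotientGroup.induction_on
  · exact mul_smul ..
  · exact hpe _

variable {A : Type*} [AddCommGroup A]

theorem IsCoxeterCocycle.exists_coboundary (hT : ∀ t ∈ T, cs.IsReflection t)
    {c : B → W ⧸ closure T → A} (hc : IsCoxeterCocycle cs c)
    (hfix : ∀ i x, cs.simple i • x = x → c i x = 0) :
    ∃ f : W ⧸ closure T → A, ∀ i x, f (cs.simple i • x) = f x + c i x := by
  let : MulAction W ((W ⧸ closure T) × A) := MulAction.compHom _ hc.skewHom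
  have hsimple (i : B) (x : W ⧸ closure T) (a : A) :
      cs.simple i • (x, a) = (cs.simple i • x, a + c i x) := hc.skewHom_simple_apply i x a
  let p : (W ⧸ closure T) × A →[W] W ⧸ closure T := ⟨Prod.fst, hc.skewHom_apply_fst⟩
  obtain ⟨σ, hσ⟩ := exists_equivariant_section hT p (fun x => ⟨(x, 0), rfl⟩) fun i ⟨x, a⟩ hx => by
    rw [hsimple, hfix i x hx, add_zero]
    exact congrArg (·, a) hx
  refine ⟨fun x => (σ x).2, fun i x => ?_⟩
  have hσx : σ x = (x, (σ x).2) := Prod.ext (hσ x) rfl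
  change (σ (cs.simple i • x)).2 = (σ x).2 + c i x
  rw [map_smul, hσx, hsimple]

theorem simple_smul_eq_self_of_simple_smul_eq (hT : ∀ t ∈ T, cs.IsReflection t) {i j : B}
    (hij : i ≠ j) (hi : ∀ k, k ≠ i → k ≠ j → M i k = 0) {y : W ⧸ closure T}
    (hy : cs.simple i • y = cs.simple j • y) : cs.simple i • y = y := by
  classical
  have hswap (k : B) (x y : W ⧸ closure T) : cs.simple k • x = y ↔ x = cs.simple k • y := by
    rw [smul_eq_iff_eq_inv_smul, cs.inv_simple]
  let h : W ⧸ closure T → ZMod (M i j) := Pi.single y 1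
  have hh (x : W ⧸ closure T) : h (cs.simple i • x) = h (cs.simple j • x) := by
    simp only [h, Pi.single_apply, hswap, hy]
  have hc := isCoxeterCocycle_single hi (fun a => by simp) hh
  obtain ⟨f, hf⟩ := hc.exists_coboundary hT fun k x hx => by
    by_cases hk : k = i
    · subst hk
      rw [Pi.single_eq_same, hx, sub_self]
    · rw [Pi.single_eq_of_ne hk, Pi.zero_apply]
  have hfi := hf i y
  have hfj := hf j y
  rw [Pi.single_eq_same] at hfi
  rw [Pi.single_eq_of_ne hij.symm, Pi.zero_apply, ← hy, hfi, add_right_inj, sub_eq_zero] at hfj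
  have : Nontrivial (ZMod (M i j)) := ZMod.nontrivial_iff.2 (M.off_diagonal i j hij)
  by_contra hne
  simp [h, hne] at hfj

variable {I J : Set B}

theorem exists_forall_simple_smul_eq_and_sub_eq (hT : ∀ t ∈ T, cs.IsReflection t)
    (hIJ : I ∪ J = Set.univ) (hM : ∀ i ∉ J, ∀ j ∉ I, M i j = 0) (g : W ⧸ closure T → A)
    (hg : ∀ k ∈ I ∩ J, ∀ x, g (cs.simple k • x) = g x) :
    ∃ f : W ⧸ closure T → A, (∀ i ∈ I, ∀ x, f (cs.simple i • x) = f x) ∧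
      ∀ j ∈ J, ∀ x, (g - f) (cs.simple j • x) = (g - f) x := by
  classical
  let c (k : B) (x : W ⧸ closure T) : A := if k ∈ I then 0 else g (cs.simple k • x) - g x
  have hcI : ∀ k ∈ I, ∀ x, c k x = 0 := fun k hk x => if_pos hk
  have hcJ : ∀ k ∈ J, ∀ x, c k x = g (cs.simple k • x) - g x := fun k hkJ x => by
    by_cases hkI : k ∈ I
    · rw [hcI k hkI, hg k ⟨hkI, hkJ⟩, sub_self]
    · exact if_neg hkI
  have hc : IsCoxeterCocycle cs c := fun k l x => by
    by_cases hklI : k ∈ I ∧ l ∈ I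
    · exact braidSum_eq_zero_of_coboundary (h := 0) (by simp [hcI k hklI.1])
        (by simp [hcI l hklI.2]) x
    by_cases hklJ : k ∈ J ∧ l ∈ J
    · exact braidSum_eq_zero_of_coboundary (hcJ k hklJ.1) (hcJ l hklJ.2) x
    refine braidSum_eq_zero_of_matrix_eq_zero c ?_ x
    have hk : k ∈ I ∪ J := hIJ ▸ Set.mem_univ k
    have hl : l ∈ I ∪ J := hIJ ▸ Set.mem_univ l
    by_cases hkJ : k ∈ J
    · rw [M.symmetric]
      exact hM l (fun hlJ => hklJ ⟨hkJ, hlJ⟩) k fun hkI => by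
        have hlJ : l ∉ J := fun hlJ => hklJ ⟨hkJ, hlJ⟩
        exact hklI ⟨hkI, hl.resolve_right hlJ⟩
    · exact hM k hkJ l fun hlI => hklI ⟨hk.resolve_right hkJ, hlI⟩
  obtain ⟨f, hf⟩ := hc.exists_coboundary hT fun k x hx => by
    simp only [c, hx, sub_self, ite_self]
  refine ⟨f, fun i hi x => by rw [hf, hcI i hi, add_zero], fun j hj x => ?_⟩
  rw [Pi.sub_apply, Pi.sub_apply, hf, hcJ j hj]
  abel

/-- The standard parabolic subgroup generated by the simple reflections in `J`. -/
def parabolicSubgroup (cs : CoxeterSystem M W) (J : Set B) : Subgroup W :=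
  closure (cs.simple '' J)

/-- The set of orbits of the standard parabolic subgroup `W_J` on `X`. -/
abbrev ParabolicOrbits (cs : CoxeterSystem M W) (J : Set B) (X : Type*) [MulAction W X] : Type _ :=
  orbitRel.Quotient (parabolicSubgroup cs J) X

theorem apply_eq_of_orbitRel_parabolicSubgroup {X Y : Type*} [MulAction W X] {f : X → Y}
    (hf : ∀ i ∈ J, ∀ x, f (cs.simple i • x) = f x) {x y : X}
    (hxy : orbitRel (parabolicSubgroup cs J) X x y) : f x = f y := by
  obtain ⟨⟨w, hw⟩, rfl⟩ := hxy
  exact apply_smul_eq_of_mem_closure (by simpa using hf) hw y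

theorem card_orbits_inter_add_one_le [Finite (W ⧸ closure T)] (hT : ∀ t ∈ T, cs.IsReflection t)
    (hIJ : I ∪ J = Set.univ) (hM : ∀ i ∉ J, ∀ j ∉ I, M i j = 0) :
    Nat.card (ParabolicOrbits cs (I ∩ J) (W ⧸ closure T)) + 1 ≤
      Nat.card (ParabolicOrbits cs I (W ⧸ closure T)) +
        Nat.card (ParabolicOrbits cs J (W ⧸ closure T)) := by
  let X := W ⧸ closure T
  let orb (K : Set B) : X → ParabolicOrbits cs K X := Quotient.mk _
  have horb (K : Set B) : ∀ i ∈ K, ∀ x, orb K (cs.simple i • x) = orb K x := fun i hi x =>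
    Quotient.sound (s := orbitRel _ X) ⟨⟨_, subset_closure ⟨i, hi, rfl⟩⟩, rfl⟩
  have : Nonempty (ParabolicOrbits cs (I ∩ J) X) :=
    ⟨orb _ ((1 : W) : X)⟩
  refine card_add_one_le_of_forall_eq_comp_add_comp
    (Quotient.lift (orb I) fun _ _ => apply_eq_of_orbitRel_parabolicSubgroup fun i hi =>
      horb I i hi.1)
    (Quotient.lift (orb J) fun _ _ => apply_eq_of_orbitRel_parabolicSubgroup fun i hi =>
      horb J i hi.2) fun g => ?_
  obtain ⟨f, hfI, hfJ⟩ := exists_forall_simple_smul_eq_and_sub_eq hT hIJ hM (g ∘ orb (I ∩ J))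
    fun k hk x => congrArg g (horb _ k hk x)
  refine ⟨Quotient.lift f fun _ _ => apply_eq_of_orbitRel_parabolicSubgroup hfI,
    Quotient.lift (g ∘ orb (I ∩ J) - f) fun _ _ => apply_eq_of_orbitRel_parabolicSubgroup hfJ,
    fun q => ?_⟩
  induction q using Quotient.inductionOn
  exact (add_sub_cancel _ _).symm

theorem parabolicSubgroup_singleton_le (i : B) :
    parabolicSubgroup cs {i} ≤ zpowers (cs.simple i) := by
  rw [parabolicSubgroup, Set.image_singleton, zpowers_eq_closure]

theorem four_mul_card_orbits_parabolicSubgroup_le {X : Type*} [MulAction W X] [Finite X] {i j : B}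
    (hm : (M i j).Coprime 6)
    (hfix : ∀ x : X, cs.simple i • x = cs.simple j • x → cs.simple i • x = x) :
    4 * Nat.card (ParabolicOrbits cs {i, j} X) ≤
      4 * (fixedBy X (cs.simple i) ∩ fixedBy X (cs.simple j)).ncard +
        (fixedBy X (cs.simple j))ᶜ.ncard :=
  four_mul_card_orbits_le (cs.simple_mul_simple_self i) (cs.simple_mul_simple_self j)
    (cs.simple_mul_simple_pow i j) hm hfix (subset_closure ⟨i, by simp, rfl⟩)
    (subset_closure ⟨j, by simp, rfl⟩)

theorem card_orbits_singleton_add_one_le [Finite (W ⧸ closure T)]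
    (hT : ∀ t ∈ T, cs.IsReflection t) {i j k : B} (hB : ∀ l, l = i ∨ l = j ∨ l = k)
    (hMik : M i k = 0) :
    Nat.card (ParabolicOrbits cs {j} (W ⧸ closure T)) + 1 ≤
      Nat.card (ParabolicOrbits cs {i, j} (W ⧸ closure T)) +
        Nat.card (ParabolicOrbits cs {k, j} (W ⧸ closure T)) := by
  have hik : i ≠ k := by
    rintro rfl
    exact one_ne_zero ((M.diagonal i).symm.trans hMik)
  have hunion : {i, j} ∪ {k, j} = (Set.univ : Set B) := Set.eq_univ_of_forall fun l => by
    rcases hB l with rfl | rfl | rfl <;> simp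
  have hinter : {i, j} ∩ {k, j} = ({j} : Set B) := by
    ext l
    grind only [= Set.mem_inter_iff, = Set.mem_insert_iff, = Set.mem_singleton_iff]
  have hM : ∀ a ∉ ({k, j} : Set B), ∀ b ∉ ({i, j} : Set B), M a b = 0 := fun a ha b hb => by
    simp only [Set.mem_insert_iff, Set.mem_singleton_iff, not_or] at ha hb
    obtain rfl : a = i := (hB a).resolve_right fun h => h.elim ha.2 ha.1
    obtain rfl : b = k := ((hB b).resolve_left hb.1).resolve_left hb.2
    exact hMik
  simpa only [hinter] using card_orbits_inter_add_one_le hT hunion hM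

theorem ncard_fixedBy_lt_ncard_inter_add_ncard_inter [Finite (W ⧸ closure T)]
    (hT : ∀ t ∈ T, cs.IsReflection t) {i j k : B} (hB : ∀ l, l = i ∨ l = j ∨ l = k)
    (hMik : M i k = 0) (hMij : (M i j).Coprime 6) (hMkj : (M k j).Coprime 6) :
    (fixedBy (W ⧸ closure T) (cs.simple j)).ncard <
      (fixedBy (W ⧸ closure T) (cs.simple i) ∩ fixedBy (W ⧸ closure T) (cs.simple j)).ncard +
        (fixedBy (W ⧸ closure T) (cs.simple k) ∩ fixedBy (W ⧸ closure T) (cs.simple j)).ncard := by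
  have hij : i ≠ j := by
    rintro rfl
    simp [M.symmetric k i, hMik] at hMkj
  have hkj : k ≠ j := by
    rintro rfl
    simp [hMik] at hMij
  have hleafi (l : B) (hli : l ≠ i) (hlj : l ≠ j) : M i l = 0 := by
    rwa [((hB l).resolve_left hli).resolve_left hlj]
  have hleafk (l : B) (hlk : l ≠ k) (hlj : l ≠ j) : M k l = 0 := by
    rwa [(hB l).resolve_right fun h => h.elim hlj hlk, M.symmetric]
  let X := W ⧸ closure T
  let F (l : B) : Set X := fixedBy X (cs.simple l)
  have horbits_ij : 4 * Nat.card (ParabolicOrbits cs {i, j} X) ≤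
      4 * (F i ∩ F j).ncard + (F j)ᶜ.ncard :=
    four_mul_card_orbits_parabolicSubgroup_le hMij fun _ =>
      simple_smul_eq_self_of_simple_smul_eq hT hij hleafi
  have horbits_kj : 4 * Nat.card (ParabolicOrbits cs {k, j} X) ≤
      4 * (F k ∩ F j).ncard + (F j)ᶜ.ncard :=
    four_mul_card_orbits_parabolicSubgroup_le hMkj fun _ =>
      simple_smul_eq_self_of_simple_smul_eq hT hkj hleafk
  have horbits_j : Nat.card X + (F j).ncard ≤ 2 * Nat.card (ParabolicOrbits cs {j} X) :=
    card_add_ncard_fixedBy_le_two_mul_card_orbits (cs.simple_mul_simple_self j)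
      (parabolicSubgroup_singleton_le j)
  have htree : Nat.card (ParabolicOrbits cs {j} X) + 1 ≤
      Nat.card (ParabolicOrbits cs {i, j} X) + Nat.card (ParabolicOrbits cs {k, j} X) :=
    card_orbits_singleton_add_one_le hT hB hMik
  have hcompl := Set.ncard_add_ncard_compl (F j)
  change (F j).ncard < (F i ∩ F j).ncard + (F k ∩ F j).ncard
  omega

theorem eq_top_of_forall_simple_smul_eq {V : Subgroup W} {x : W ⧸ V}
    (hx : ∀ i, cs.simple i • x = x) : V = ⊤ := by
  refine eq_top_of_forall_smul_eq (x := x) fun w => ?_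
  induction w using cs.simple_induction with
  | simple i => exact hx i
  | one => exact one_smul W x
  | mul v w ihv ihw => rw [mul_smul, ihw, ihv]

end ReflectionSubgroup

/-- The three simple reflections `s₁, s₂, s₃` are indexed by `0, 1, 2 : Fin 3`; in a `CoxeterMatrix`
an infinite label is encoded by `0`, so the hypotheses say that `m₁₃ = ∞` and that `m₁₂ * m₂₃` is
divisible neither by `2` nor by `3` (in particular `m₁₂` and `m₂₃` are finite). -/
theorem lemma5p11 {W : Type*} [Group W] (M : CoxeterMatrix (Fin 3)) (cs : CoxeterSystem M W)
    (h13 : M 0 2 = 0) (h2 : ¬ 2 ∣ M 0 1 * M 1 2) (h3 : ¬ 3 ∣ M 0 1 * M 1 2) :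
    ¬ ∃ V : Subgroup W, cs.IsReflectionSubgroup V ∧ V.FiniteIndex := by
  rintro ⟨_, ⟨hne, T, hT, rfl⟩, _⟩
  have hm : (M 0 1 * M 1 2).Coprime (2 * 3) :=
    .mul_right (Nat.prime_two.coprime_iff_not_dvd.2 h2).symm
      (Nat.prime_three.coprime_iff_not_dvd.2 h3).symm
  have hlt := ncard_fixedBy_lt_ncard_inter_add_ncard_inter (cs := cs) (i := 0) (j := 1) (k := 2)
    hT (by decide) h13 hm.coprime_mul_right (M.symmetric 1 2 ▸ hm.coprime_mul_left)
  obtain ⟨x, ⟨hx0, hx1⟩, hx2, -⟩ := inter_nonempty_of_ncard_lt_ncard_add_ncard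
    Set.inter_subset_right Set.inter_subset_right hlt
  have hx : ∀ i, cs.simple i • x = x
    | 0 => hx0
    | 1 => hx1
    | 2 => hx2
  exact hne (eq_top_of_forall_simple_smul_eq hx)
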